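/- Let $\Gamma$ be a non-elementary word hyperbolic group, that is, a finitely generated group whose word metric is Gromov hyperbolic and whose Gromov boundary has more than two points. Let $\mu$ be a probability measure on $\Gamma$ which is symmetric ($\mu(x^{-1})=\mu(x)$ for all $x\in\Gamma$) and admissible (the support of $\mu$ generates $\Gamma$). For $f:\Gamma\to\mathbb{R}$ put $$\mathcal{E}^\mu(f,f)=\sum_{x,y\in\Gamma}\mu(x^{-1}y)\,(f(x)-f(y))^2\in[0,\infty],\qquad \mathcal{F}^\mu=\{f:\Gamma\to\mathbb{R}\;;\;\mathcal{E}^\mu(f,f)<\infty\},$$ and for $f,g\in\mathcal{F}^\mu$ let $\mathcal{E}^\mu(f,g)=\sum_{x,y\in\Gamma}\mu(x^{-1}y)(f(x)-f(y))(g(x)-g(y))$ be the associated bilinear form. Put $$\ell_2(\Gamma)=\Big\{f:\Gamma\to\mathbb{R}\;;\;\sum_{x\in\Gamma}f(x)^2<\infty\Big\},\qquad \mathbb{HD}(\mu)=\{f\in\mathcal{F}^\mu\;;\;\Delta_\mu f=0\text{ on }\Gamma\},$$ where $\Delta_\mu f(x)=\sum_{y\in\Gamma}\mu(x^{-1}y)f(y)-f(x)$,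 and let $C_0(\Gamma)$ be the set of finitely supported functions $\Gamma\to\mathbb{R}$. Then the following hold. 1. $\ell_2(\Gamma)\subset\mathcal{F}^\mu$. 2. For every $f\in\mathcal{F}^\mu$ there is a unique pair $(f_0,f_{\mathbb{HD}})\in\ell_2(\Gamma)\times\mathbb{HD}(\mu)$ such that $f=f_0+f_{\mathbb{HD}}$. 3. For all $f_0\in\ell_2(\Gamma)$ and $h\in\mathbb{HD}(\mu)$ one has $\mathcal{E}^\mu(f_0+h,f_0+h)=\mathcal{E}^\mu(f_0,f_0)+\mathcal{E}^\mu(h,h)$, and $\mathcal{E}^\mu(f_0,h)=0$, the series that defines $\mathcal{E}^\mu(f_0,h)$ being absolutely convergent. In other words, $\mathcal{F}^\mu=\ell_2(\Gamma)\oplus\mathbb{HD}(\mu)$ is an orthogonal decomposition for $\mathcal{E}^\mu$. 4. $\ell_2(\Gamma)$ is the closure of $C_0(\Gamma)$ with respect to $\mathcal{E}^\mu_1(f,f)=\mathcal{E}^\mu(f,f)+\sum_{x\in\Gamma}f(x)^2$: a function $f:\Gamma\to\mathbb{R}$ belongs to $\ell_2(\Gamma)$ if and only if for every $\varepsilon>0$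 there is $g\in C_0(\Gamma)$ with $\mathcal{E}^\mu_1(f-g,f-g)<\varepsilon$. -/

import Mathlib

open scoped ENNReal

noncomputable section

/-! ### Non-elementary word hyperbolic groups -/

section Hyperbolic

variable {Γ : Type*} [Group Γ]

/-- The left-invariant word metric of `Γ` with respect to `S`: the graph distance in the Cayley
graph in which `x` is joined to `x * s` for every `s ∈ S` (unoriented edges, so that `S` is
implicitly symmetrized). -/
def wordDist (S : Set Γ) (x y : Γ) : ℕ := (SimpleGraph.mulCayley S).dist x y

/-- The Gromov product `(x | y)_w` for the word metric. -/
def gromovProduct (S : Set Γ) (w x y : Γ) : ℝ :=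
  ((wordDist S w x : ℝ) + (wordDist S w y : ℝ) - (wordDist S x y : ℝ)) / 2

/-- Gromov hyperbolicity of `Γ` with the word metric of `S`. -/
def IsHyperbolicWordMetric (S : Set Γ) : Prop :=
  ∃ δ : ℝ, ∀ w x y z : Γ,
    min (gromovProduct S w x y) (gromovProduct S w y z) - δ ≤ gromovProduct S w x z

/-- Geodesic rays of the Cayley graph that start at a vertex, given by their sequence of
vertices. -/
def GeodesicRay (S : Set Γ) : Type _ :=
  {r : ℕ → Γ // ∀ m n : ℕ, wordDist S (r m) (r (m + n)) = n}

/-- Two geodesic rays are asymptotic if they stay at bounded distance from each other. -/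
def asymptoticSetoid (S : Set Γ) : Setoid (GeodesicRay S) where
  r a b := ∃ C : ℕ, ∀ n : ℕ, (SimpleGraph.mulCayley S).edist (a.1 n) (b.1 n) ≤ C
  iseqv :=
    { refl := fun a => ⟨0, fun n => by simp⟩
      symm := fun {a b} ⟨C, hC⟩ => ⟨C, fun n => by
        rw [SimpleGraph.edist_comm]; exact hC n⟩
      trans := fun {a b c} ⟨C, hC⟩ ⟨D, hD⟩ => ⟨C + D, fun n => by
        push_cast
        exact SimpleGraph.edist_triangle.trans (add_le_add (hC n) (hD n))⟩ }

/-- The Gromov boundary: geodesic rays up to bounded distance. -/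
def GromovBoundary (S : Set Γ) : Type _ := Quotient (asymptoticSetoid S)

variable (Γ) in
/-- `Γ` is a non-elementary word hyperbolic group: it has a finite generating set whose word metric
is Gromov hyperbolic, and its Gromov boundary has more than two points. -/
def IsNonElementaryHyperbolicGroup : Prop :=
  ∃ S : Set Γ, S.Finite ∧ Subgroup.closure S = ⊤ ∧ IsHyperbolicWordMetric S ∧
    2 < ENat.card (GromovBoundary S)

end Hyperbolic

/-! ### The Dirichlet form of a random walk -/

section Energy

variable {Γ : Type*} [Group Γ]

/-- `μ (x⁻¹) = μ x` for all `x`. -/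
def IsSymmetricMeasure (μ : PMF Γ) : Prop := ∀ x : Γ, μ x⁻¹ = μ x

/-- The support of `μ` generates `Γ`. -/
def IsAdmissible (μ : PMF Γ) : Prop := Subgroup.closure μ.support = ⊤

/-- The energy `𝓔^μ(f, f) = ∑_{x, y} μ(x⁻¹ y) (f x - f y)²`, with values in `[0, ∞]`. -/
def walkEnergy (μ : PMF Γ) (f : Γ → ℝ) : ℝ≥0∞ :=
  ∑' x : Γ, ∑' y : Γ, μ (x⁻¹ * y) * ENNReal.ofReal ((f x - f y) ^ 2)

/-- The full domain `𝓕^μ` of functions with finite energy. -/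
def finiteEnergy (μ : PMF Γ) : Set (Γ → ℝ) := {f | walkEnergy μ f < ∞}

/-- The discrete Laplacian `Δ_μ f(x) = ∑_y μ(x⁻¹ y) f(y) - f(x)`. The series converges absolutely
for every `f` of finite energy, the only functions to which the Laplacian is applied below. -/
def walkLaplacian (μ : PMF Γ) (f : Γ → ℝ) (x : Γ) : ℝ :=
  (∑' y : Γ, (μ (x⁻¹ * y)).toReal * f y) - f x

/-- `𝐇𝐃(μ)`: the `μ`-harmonic functions with finite energy. -/
def harmonicFiniteEnergy (μ : PMF Γ) : Set (Γ → ℝ) :=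
  {f | f ∈ finiteEnergy μ ∧ ∀ x : Γ, walkLaplacian μ f x = 0}

variable (Γ) in
/-- `ℓ²(Γ)`: the square-summable real functions on `Γ`. -/
def ellTwo : Set (Γ → ℝ) := {f | Summable fun x : Γ => f x ^ 2}

variable (Γ) in
/-- `C₀(Γ)`: the finitely supported real functions on `Γ`. -/
def finitelySupported : Set (Γ → ℝ) := {f | (Function.support f).Finite}

/-- `𝓔^μ_1(f, f) = 𝓔^μ(f, f) + ∑_x f(x)²`, with values in `[0, ∞]`. -/
def walkEnergyOne (μ : PMF Γ) (f : Γ → ℝ) : ℝ≥0∞ :=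
  walkEnergy μ f + ∑' x : Γ, ENNReal.ofReal (f x ^ 2)

/-- The closure of a set of functions for `𝓔^μ_1`: the functions `f` for which `𝓔^μ_1(f - g, f - g)`
can be made arbitrarily small with `g` in the set. -/
def energyOneClosure (μ : PMF Γ) (A : Set (Γ → ℝ)) : Set (Γ → ℝ) :=
  {f | ∀ ε : ℝ≥0∞, 0 < ε → ∃ g ∈ A, walkEnergyOne μ (f - g) < ε}

end Energy

end

/-!
The content of the theorem is the spectral gap `∑ f² ≤ C 𝓔^μ(f, f)` on `ℓ²(Γ)`; given the gap,
the rest is Hilbert space theory.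

*The gap.* By hyperbolicity, non-asymptotic geodesic rays have bounded Gromov products, so three
boundary points give three diverging directions at `1`, and by left invariance at every point. At
most one of them points towards a prescribed point, so from every `y` at least two lead away from
`1`. Iterating (`exists_branching`), each `y` has as many points `x` as one likes at distance `R`
with `(x | 1)_y ≤ C`, where `C` does not depend on their number. Conversely all `y` in this
relation to a given `x` lie at distance about `R` from `x` along a geodesic from `x` to `1`, so
they lie in a ball whose radius depends only on `C` and `δ`. This doubling relation
(`exists_doubling_relation`) turns into an inequality by double counting: comparing `f(y)²` with
`f(x)²` over all related pairs bounds `∑ f²` by the energies of finitely many right translations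
(`exists_sqSum_le_translationEnergy`), and these are bounded by `𝓔^μ` because the support of `μ`
generates `Γ` (`exists_translationEnergy_le_walkEnergy`). This is the non-amenability of `Γ`,
obtained without free subgroups.

*The decomposition.* Put `df(x, y) = √μ(x⁻¹y) (f(x) - f(y))`, so that `𝓔^μ(f, g) = ⟪df, dg⟫` in
`ℓ²(Γ × Γ)`. On `ℓ²(Γ)` the operator `d` is bounded, and by the gap its range is closed. By the
symmetry of `μ`, `⟪dδ_x, dh⟫ = -2 Δ_μ h(x)` (`inner_edgeDiff_single`), so a function `h` of finite
energy is harmonic exactly if `dh` is orthogonal to that range. Projecting `df` orthogonally to the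
range gives the decomposition, and the gap gives its uniqueness. The last assertion holds because
`𝓔^μ_1` is comparable to the square of the norm of `ℓ²(Γ)`, in which finitely supported functions
are dense.
-/

/-! ### Word metrics and Gromov products -/

section WordMetric

variable {Γ : Type*} [Group Γ] {S : Set Γ}

/-- Left translation as a homomorphism of the Cayley graph. -/
def cayleyTranslation (S : Set Γ) (g : Γ) :
    SimpleGraph.mulCayley S →g SimpleGraph.mulCayley S where
  toFun x := g * x
  map_rel' h := SimpleGraph.mulCayley_adj_mul_iff_right.2 h

lemma mulCayley_connected (hS : Subgroup.closure S = ⊤) :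
    (SimpleGraph.mulCayley S).Connected := by
  have translate : ∀ (g x y : Γ), (SimpleGraph.mulCayley S).Reachable x y →
      (SimpleGraph.mulCayley S).Reachable (g * x) (g * y) := fun g x y h =>
    h.map (cayleyTranslation S g)
  have key : ∀ x : Γ, (SimpleGraph.mulCayley S).Reachable 1 x := by
    intro x
    have hx : x ∈ Subgroup.closure S := hS ▸ Subgroup.mem_top x
    induction hx using Subgroup.closure_induction with
    | mem s hs =>
      by_cases h1 : 1 = s
      · rw [← h1]
      · exact SimpleGraph.Adj.reachable
          ((SimpleGraph.mulCayley_adj S 1 s).2 ⟨h1, Or.inl (by simpa using hs)⟩)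
    | one => exact SimpleGraph.Reachable.refl _
    | mul x y _ _ hx hy =>
      have := translate x 1 y hy
      rw [mul_one] at this
      exact hx.trans this
    | inv x _ hx =>
      have := translate x⁻¹ 1 x hx
      rw [mul_one, inv_mul_cancel] at this
      exact this.symm
  exact { preconnected := fun x y => (key x).symm.trans (key y), nonempty := ⟨1⟩ }

lemma wordDist_self (x : Γ) : wordDist S x x = 0 := SimpleGraph.dist_self

lemma wordDist_comm (x y : Γ) : wordDist S x y = wordDist S y x := SimpleGraph.dist_comm

lemma wordDist_triangle (hS : Subgroup.closure S = ⊤) (x y z : Γ) :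
    (wordDist S x z : ℝ) ≤ wordDist S x y + wordDist S y z := by
  exact_mod_cast (mulCayley_connected hS).dist_triangle

lemma wordDist_mul_left (hS : Subgroup.closure S = ⊤) (g x y : Γ) :
    wordDist S (g * x) (g * y) = wordDist S x y := by
  have le : ∀ (g x y : Γ), wordDist S (g * x) (g * y) ≤ wordDist S x y := by
    intro g x y
    obtain ⟨p, hp⟩ := (mulCayley_connected hS).exists_walk_length_eq_dist x y
    have := SimpleGraph.dist_le (p.map (cayleyTranslation S g))
    rw [SimpleGraph.Walk.length_map, hp] at this
    exact this
  refine le_antisymm (le g x y) ?_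
  simpa using le g⁻¹ (g * x) (g * y)

/-- The point at distance `R` from `1` on a geodesic from `1` to `u`. -/
lemma exists_wordDist_eq (hS : Subgroup.closure S = ⊤) {u : Γ} {R : ℕ}
    (hR : R ≤ wordDist S 1 u) :
    ∃ v : Γ, wordDist S 1 v = R ∧ R + wordDist S v u = wordDist S 1 u := by
  obtain ⟨p, hp⟩ := (mulCayley_connected hS).exists_walk_length_eq_dist 1 u
  have h1 := SimpleGraph.dist_le (p.take R)
  have h2 := SimpleGraph.dist_le (p.drop R)
  have h3 : (SimpleGraph.mulCayley S).dist 1 u ≤ _ :=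
    (mulCayley_connected hS).dist_triangle (v := p.getVert R)
  rw [SimpleGraph.Walk.take_length] at h1
  rw [SimpleGraph.Walk.drop_length] at h2
  unfold wordDist at hR ⊢
  refine ⟨p.getVert R, ?_, ?_⟩ <;> omega

lemma finite_wordDist_le (hfin : S.Finite) (hS : Subgroup.closure S = ⊤) (n : ℕ) :
    {g : Γ | wordDist S 1 g ≤ n}.Finite := by
  induction n with
  | zero =>
    refine (Set.finite_singleton (1 : Γ)).subset fun g hg => ?_
    have : wordDist S 1 g = 0 := Nat.le_zero.1 hg
    exact ((mulCayley_connected hS).dist_eq_zero_iff.1 this).symm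
  | succ n ih =>
    refine (ih.union (ih.mul (hfin.union hfin.inv))).subset fun g hg => ?_
    by_cases h : wordDist S 1 g ≤ n
    · exact Or.inl h
    · right
      obtain ⟨v, hv, hvg⟩ := exists_wordDist_eq (u := g) (R := n) hS (by omega)
      have hg' : wordDist S 1 g ≤ n + 1 := hg
      have h1 : wordDist S v g = 1 := by omega
      have hadj := SimpleGraph.dist_eq_one_iff_adj.1 h1
      rw [SimpleGraph.mulCayley_adj] at hadj
      refine Set.mem_mul.2 ⟨v, hv.le, v⁻¹ * g, ?_, by simp⟩
      rcases hadj.2 with h | h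
      · exact Or.inl h
      · exact Or.inr (by simpa using h)

lemma gromovProduct_comm (w x y : Γ) : gromovProduct S w x y = gromovProduct S w y x := by
  unfold gromovProduct
  rw [wordDist_comm x y]
  ring

lemma gromovProduct_mul_left (hS : Subgroup.closure S = ⊤) (g w x y : Γ) :
    gromovProduct S (g * w) (g * x) (g * y) = gromovProduct S w x y := by
  simp only [gromovProduct, wordDist_mul_left hS]

/-- Cutting a geodesic from `1` to `u` at length `R` does not increase Gromov products. -/
lemma exists_truncation (hS : Subgroup.closure S = ⊤) {u : Γ} {R : ℕ}
    (hR : R ≤ wordDist S 1 u) :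
    ∃ v : Γ, wordDist S 1 v = R ∧
      ∀ z, gromovProduct S 1 v z ≤ gromovProduct S 1 u z := by
  obtain ⟨v, hv, hvu⟩ := exists_wordDist_eq hS hR
  refine ⟨v, hv, fun z => ?_⟩
  have h1 := wordDist_triangle hS u v z
  have h2 : (R : ℝ) + wordDist S v u = wordDist S 1 u := by exact_mod_cast hvu
  rw [wordDist_comm u v] at h1
  unfold gromovProduct
  rw [hv]
  linarith

end WordMetric

/-! ### Branching in non-elementary hyperbolic groups -/

section Branching

variable {Γ : Type*} [Group Γ] {S : Set Γ} {δ : ℝ}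

/-- Two geodesic rays with unbounded Gromov products are asymptotic. The rays may start at
different points, which only shifts the constants. -/
lemma gromovProduct_le_of_not_asymptotic (hS : Subgroup.closure S = ⊤)
    (hδ : ∀ w x y z : Γ,
      min (gromovProduct S w x y) (gromovProduct S w y z) - δ ≤ gromovProduct S w x z)
    (a b : GeodesicRay S) (hab : ¬ (asymptoticSetoid S) a b) :
    ∃ K : ℝ, ∀ n m : ℕ, gromovProduct S 1 (a.1 n) (b.1 m) ≤ K := by
  by_contra hK
  push Not at hK
  apply hab
  have hδ0 : 0 ≤ δ := by simpa using hδ 1 1 1 1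
  obtain ⟨C, hC⟩ := exists_nat_ge (5 * (wordDist S (a.1 0) (b.1 0) : ℝ) + 4 * δ)
  refine ⟨C, fun t => ?_⟩
  rw [← ((mulCayley_connected hS).preconnected _ _).coe_dist_eq_edist]
  norm_cast
  obtain ⟨n, m, hnm⟩ := hK (t + wordDist S 1 (a.1 0))
  have ra : ∀ i j : ℕ, (wordDist S (a.1 i) (a.1 (i + j)) : ℝ) = j := fun i j => by
    exact_mod_cast a.2 i j
  have rb : ∀ i j : ℕ, (wordDist S (b.1 i) (b.1 (i + j)) : ℝ) = j := fun i j => by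
    exact_mod_cast b.2 i j
  have tri := wordDist_triangle hS
  have comm : ∀ x y : Γ, (wordDist S x y : ℝ) = wordDist S y x := fun x y => by
    rw [wordDist_comm]
  -- the base point `1` is replaced by the origin of the ray `a`
  have hbase : (t : ℝ) ≤ gromovProduct S (a.1 0) (a.1 n) (b.1 m) := by
    unfold gromovProduct at hnm ⊢
    have h1 := tri 1 (a.1 0) (a.1 n)
    have h2 := tri 1 (a.1 0) (b.1 m)
    linarith
  have han := ra 0 n
  have hbm := rb 0 m
  have hat := ra 0 t
  have hbt := rb 0 t
  simp only [Nat.zero_add] at han hbm hat hbt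
  have htn : t ≤ n := by
    have h1 := tri (a.1 0) (a.1 n) (b.1 m)
    unfold gromovProduct at hbase
    have : (t : ℝ) ≤ n := by linarith
    exact_mod_cast this
  have htm : (t : ℝ) ≤ m + wordDist S (a.1 0) (b.1 0) := by
    have h1 := tri (a.1 0) (b.1 m) (a.1 n)
    have h2 := tri (a.1 0) (b.1 0) (b.1 m)
    rw [comm (b.1 m)] at h1
    unfold gromovProduct at hbase
    linarith
  have hatn : (t : ℝ) ≤ gromovProduct S (a.1 0) (a.1 t) (a.1 n) := by
    have h1 := ra t (n - t)
    rw [Nat.add_sub_cancel' htn, Nat.cast_sub htn] at h1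
    unfold gromovProduct
    linarith
  have hbtm : (t : ℝ) - 2 * wordDist S (a.1 0) (b.1 0) ≤
      gromovProduct S (a.1 0) (b.1 m) (b.1 t) := by
    have h1 := tri (b.1 0) (a.1 0) (b.1 m)
    have h2 := tri (b.1 0) (a.1 0) (b.1 t)
    rw [comm (b.1 0) (a.1 0)] at h1 h2
    unfold gromovProduct
    rcases le_total t m with h | h
    · have h3 := rb t (m - t)
      rw [Nat.add_sub_cancel' h, Nat.cast_sub h, comm] at h3
      linarith
    · have h3 := rb m (t - m)
      rw [Nat.add_sub_cancel' h, Nat.cast_sub h] at h3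
      linarith
  have hab0 : (0 : ℝ) ≤ wordDist S (a.1 0) (b.1 0) := Nat.cast_nonneg _
  have h1 : (t : ℝ) - 2 * wordDist S (a.1 0) (b.1 0) - δ ≤
      gromovProduct S (a.1 0) (a.1 n) (b.1 t) := by
    refine le_trans ?_ (hδ (a.1 0) (a.1 n) (b.1 m) (b.1 t))
    exact sub_le_sub_right (le_min (by linarith) hbtm) _
  have h2 : (t : ℝ) - 2 * wordDist S (a.1 0) (b.1 0) - δ - δ ≤
      gromovProduct S (a.1 0) (a.1 t) (b.1 t) := by
    refine le_trans ?_ (hδ (a.1 0) (a.1 t) (a.1 n) (b.1 t))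
    exact sub_le_sub_right (le_min (by linarith) h1) _
  have h3 := tri (a.1 0) (b.1 0) (b.1 t)
  unfold gromovProduct at h2
  have : (wordDist S (a.1 t) (b.1 t) : ℝ) ≤ C := by linarith
  exact_mod_cast this

/-- Three boundary points give three directions at `1`; whatever the direction `z`, at most one of
them points towards `z`. -/
lemma exists_two_directions (hS : Subgroup.closure S = ⊤)
    (hδ : ∀ w x y z : Γ,
      min (gromovProduct S w x y) (gromovProduct S w y z) - δ ≤ gromovProduct S w x z)
    (hbd : 2 < ENat.card (GromovBoundary S)) :
    ∃ K : ℝ, ∀ (m : ℕ) (z : Γ), ∃ g : Bool → Γ, (∀ i, wordDist S 1 (g i) = m) ∧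
      (∀ i, gromovProduct S 1 (g i) z ≤ K) ∧
      gromovProduct S 1 (g true) (g false) ≤ K := by
  have hδ0 : 0 ≤ δ := by simpa using hδ 1 1 1 1
  obtain ⟨ξ, hξ⟩ : ∃ ξ : Fin 3 → GromovBoundary S, Function.Injective ξ := by
    have h2 : 1 < ENat.card (GromovBoundary S) := lt_trans (by norm_num) hbd
    obtain ⟨a, b, hab⟩ := ((ENat.one_lt_card_iff_nontrivial _).1 h2).exists_pair_ne
    have h3 : 3 ≤ ENat.card (GromovBoundary S) := by
      have := Order.add_one_le_of_lt hbd
      norm_num at this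
      exact this
    obtain ⟨c, hca, hcb⟩ := ENat.exists_ne_ne_of_three_le h3 a b
    refine ⟨![a, b, c], fun i j hij => ?_⟩
    fin_cases i <;> fin_cases j <;> simp_all [eq_comm]
  choose r hr using fun i => Quotient.exists_rep (ξ i)
  have hna : ∀ i j, i ≠ j → ¬ (asymptoticSetoid S) (r i) (r j) := by
    intro i j hij h
    exact hij (hξ (by rw [← hr i, ← hr j]; exact Quotient.sound h))
  have hK : ∀ i j : Fin 3, ∃ K : ℝ, i ≠ j →
      ∀ n m : ℕ, gromovProduct S 1 ((r i).1 n) ((r j).1 m) ≤ K := by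
    intro i j
    by_cases hij : i = j
    · exact ⟨0, fun h => absurd hij h⟩
    · obtain ⟨K, hK⟩ := gromovProduct_le_of_not_asymptotic hS hδ (r i) (r j) (hna i j hij)
      exact ⟨K, fun _ => hK⟩
  choose K hK using hK
  obtain ⟨L, hL⟩ := Set.Finite.bddAbove (Set.finite_range fun p : Fin 3 × Fin 3 => K p.1 p.2)
  have hKL : ∀ i j, K i j ≤ L := fun i j => hL ⟨(i, j), rfl⟩
  refine ⟨L + δ, fun m z => ?_⟩
  have hu : ∀ i, ∃ u : Γ, wordDist S 1 u = m ∧ ∃ n,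
      ∀ z, gromovProduct S 1 u z ≤ gromovProduct S 1 ((r i).1 n) z := by
    intro i
    have hlen : m ≤ wordDist S 1 ((r i).1 (m + wordDist S 1 ((r i).1 0))) := by
      have h1 := wordDist_triangle hS ((r i).1 0) 1 ((r i).1 (m + wordDist S 1 ((r i).1 0)))
      have h2 := (r i).2 0 (m + wordDist S 1 ((r i).1 0))
      rw [Nat.zero_add] at h2
      rw [h2, wordDist_comm ((r i).1 0)] at h1
      have h3 : m + wordDist S 1 ((r i).1 0) ≤ wordDist S 1 ((r i).1 0) +
          wordDist S 1 ((r i).1 (m + wordDist S 1 ((r i).1 0))) := by exact_mod_cast h1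
      omega
    obtain ⟨u, hu, hz⟩ := exists_truncation hS hlen
    exact ⟨u, hu, _, hz⟩
  choose u hu n hn using hu
  have huu : ∀ i j, i ≠ j → gromovProduct S 1 (u i) (u j) ≤ L := by
    intro i j hij
    calc gromovProduct S 1 (u i) (u j) ≤ gromovProduct S 1 ((r i).1 (n i)) (u j) := hn i _
      _ = gromovProduct S 1 (u j) ((r i).1 (n i)) := gromovProduct_comm _ _ _
      _ ≤ gromovProduct S 1 ((r j).1 (n j)) ((r i).1 (n i)) := hn j _
      _ ≤ L := (hK j i hij.symm _ _).trans (hKL _ _)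
  have hone : ∀ i j, i ≠ j → gromovProduct S 1 (u i) z ≤ L + δ ∨
      gromovProduct S 1 (u j) z ≤ L + δ := by
    intro i j hij
    by_contra! h
    have h1 := hδ 1 (u i) z (u j)
    rw [gromovProduct_comm 1 z (u j)] at h1
    have h2 := huu i j hij
    have h3 := lt_min h.1 h.2
    linarith
  obtain ⟨i, j, hij, hi, hj⟩ : ∃ i j : Fin 3, i ≠ j ∧ gromovProduct S 1 (u i) z ≤ L + δ ∧
      gromovProduct S 1 (u j) z ≤ L + δ := by
    have h01 := hone 0 1 (by decide)
    have h02 := hone 0 2 (by decide)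
    have h12 := hone 1 2 (by decide)
    by_cases h0 : gromovProduct S 1 (u 0) z ≤ L + δ
    · rcases h12 with h | h
      · exact ⟨0, 1, by decide, h0, h⟩
      · exact ⟨0, 2, by decide, h0, h⟩
    · exact ⟨1, 2, by decide, h01.resolve_left h0, h02.resolve_left h0⟩
  refine ⟨fun b => if b then u i else u j, fun b => ?_, fun b => ?_, ?_⟩
  · cases b <;> simp [hu]
  · cases b <;> simpa
  · simpa using (huu i j hij).trans (by linarith)

/-- Iterated branching: there are `2 ^ k` diverging points on the sphere of radius `R` that all point
away from `z`. The bound `C` on the Gromov products with `z` does not depend on `k`; only the bound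
`K` on the mutual Gromov products does. -/
lemma exists_branching (hS : Subgroup.closure S = ⊤)
    (hδ : ∀ w x y z : Γ,
      min (gromovProduct S w x y) (gromovProduct S w y z) - δ ≤ gromovProduct S w x z)
    (hbd : 2 < ENat.card (GromovBoundary S)) :
    ∃ C : ℝ, ∀ k : ℕ, ∃ (ι : Type) (_ : Fintype ι), 2 ^ k ≤ Fintype.card ι ∧ ∃ K : ℝ,
      ∀ (R : ℕ) (z : Γ), ∃ x : ι → Γ, (∀ i, wordDist S 1 (x i) = R) ∧
        (∀ i, gromovProduct S 1 (x i) z ≤ C) ∧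
        ∀ i j, i ≠ j → gromovProduct S 1 (x i) (x j) ≤ K := by
  have hδ0 : 0 ≤ δ := by simpa using hδ 1 1 1 1
  obtain ⟨L, hL⟩ := exists_two_directions hS hδ hbd
  refine ⟨L + 2 * δ, fun k => ?_⟩
  induction k with
  | zero =>
    refine ⟨Unit, inferInstance, by simp, 0, fun R z => ?_⟩
    obtain ⟨g, hg, hgz, -⟩ := hL R z
    exact ⟨fun _ => g true, fun _ => hg _, fun _ => (hgz _).trans (by linarith),
      fun i j hij => absurd (Subsingleton.elim i j) hij⟩
  | succ k ih =>
    obtain ⟨ι, _, hcard, K, hK⟩ := ih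
    -- go a distance `m` in two directions away from `z`, branch there away from `1`, and cut the
    -- resulting points back to the sphere of radius `R`; the points are chosen at distance `R + M`
    -- because the concatenated paths are geodesic only up to a constant
    obtain ⟨m, hm⟩ := exists_nat_gt (2 * (L + 2 * δ))
    obtain ⟨M, hM⟩ := exists_nat_ge (2 * (L + 2 * δ))
    refine ⟨Bool × ι, inferInstance, ?_, max (K + m) (L + 2 * δ), fun R z => ?_⟩
    · rw [Fintype.card_prod, Fintype.card_bool, pow_succ]
      omega
    obtain ⟨g, hg, hgz, hgg⟩ := hL m z
    choose h hh hhg hhh using fun b => hK (R + M) (g b)⁻¹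
    have hg' : ∀ b, (wordDist S 1 (g b) : ℝ) = m := fun b => by rw [hg b]
    have hh' : ∀ b i, (wordDist S 1 (h b i) : ℝ) = R + M := fun b i => by
      rw [hh b i]; push_cast; rfl
    -- distances involving the translated points `g b * h b i`
    have d1 : ∀ b i, (wordDist S (g b) (g b * h b i) : ℝ) = R + M := fun b i => by
      rw [← hh' b i]
      conv_lhs => rw [← mul_one (g b), mul_assoc, one_mul, wordDist_mul_left hS]
    have d2 : ∀ b i, gromovProduct S (g b) (g b * h b i) 1 ≤ L + 2 * δ := fun b i => by
      have := hhg b i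
      rw [← gromovProduct_mul_left hS (g b)] at this
      simpa using this
    have hx : ∀ b i, ∃ x : Γ, wordDist S 1 x = R ∧
        ∀ z, gromovProduct S 1 x z ≤ gromovProduct S 1 (g b * h b i) z := by
      intro b i
      apply exists_truncation hS
      have h2 := d2 b i
      unfold gromovProduct at h2
      rw [d1, wordDist_comm (g b) 1, hg', wordDist_comm _ 1] at h2
      have h3 : (0 : ℝ) ≤ m := Nat.cast_nonneg _
      have : (R : ℝ) ≤ wordDist S 1 (g b * h b i) := by linarith
      exact_mod_cast this
    -- the points of the branch at `g b` keep the direction of `g b`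
    have hnear : ∀ b i, L + 2 * δ < gromovProduct S 1 (g b * h b i) (g b) := by
      intro b i
      have h2 := d2 b i
      unfold gromovProduct at h2 ⊢
      rw [wordDist_comm (g b) 1, wordDist_comm _ 1] at h2
      rw [wordDist_comm (g b * h b i) (g b)]
      have h3 := hg' b
      linarith
    choose x hxR hxz using hx
    have hxx : ∀ b i c j, gromovProduct S 1 (x b i) (x c j) ≤
        gromovProduct S 1 (g b * h b i) (g c * h c j) := by
      intro b i c j
      refine (hxz b i _).trans ?_
      rw [gromovProduct_comm]
      refine (hxz c j _).trans ?_
      rw [gromovProduct_comm]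
    have hcross : ∀ b c i j, gromovProduct S 1 (g b) (g c) ≤ L →
        gromovProduct S 1 (x b i) (x c j) ≤ L + 2 * δ := by
      intro b c i j hbc
      refine (hxx b i c j).trans ?_
      by_contra! hlt
      have h1 := hδ 1 (g b) (g b * h b i) (g c * h c j)
      have h2 := hδ 1 (g b) (g c * h c j) (g c)
      have h3 := hnear b i
      rw [gromovProduct_comm] at h3
      have h4 := lt_min h3 hlt
      have h5 : L + δ < gromovProduct S 1 (g b) (g c * h c j) := by linarith
      have h6 := lt_min h5 (lt_of_le_of_lt (by linarith) (hnear c j))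
      linarith
    refine ⟨fun p => x p.1 p.2, fun p => hxR _ _, fun p => ?_, ?_⟩
    · refine (hxz _ _ z).trans ?_
      by_contra! hlt
      have h1 := hδ 1 (g p.1) (g p.1 * h p.1 p.2) z
      have h3 := hnear p.1 p.2
      rw [gromovProduct_comm] at h3
      have h4 := lt_min h3 hlt
      have h5 := hgz p.1
      linarith
    · rintro ⟨b, i⟩ ⟨c, j⟩ hne
      by_cases hbc : b = c
      · subst hbc
        have hij : i ≠ j := fun h => hne (by rw [h])
        refine le_trans ((hxx b i b j).trans ?_) (le_max_left _ _)
        have h1 := hhh b i j hij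
        rw [← gromovProduct_mul_left hS (g b), mul_one] at h1
        have h2 := wordDist_triangle hS 1 (g b) (g b * h b i)
        have h3 := wordDist_triangle hS 1 (g b) (g b * h b j)
        rw [hg'] at h2 h3
        unfold gromovProduct at h1 ⊢
        linarith
      · refine le_trans (hcross b c i j ?_) (le_max_right _ _)
        cases b <;> cases c
        · exact absurd rfl hbc
        · rw [gromovProduct_comm]; exact hgg
        · exact hgg
        · exact absurd rfl hbc

end Branching

/-! ### Non-amenability and the spectral gap -/

section SpectralGap

variable {Γ : Type*} [Group Γ]

/-- `∑_x f(x)²`, with values in `[0, ∞]`. -/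
noncomputable def sqSum {α : Type*} (f : α → ℝ) : ℝ≥0∞ := ∑' x : α, ENNReal.ofReal (f x ^ 2)

/-- `∑_x (f(x) - f(x g))²`, with values in `[0, ∞]`. -/
noncomputable def translationEnergy (g : Γ) (f : Γ → ℝ) : ℝ≥0∞ :=
  ∑' x : Γ, ENNReal.ofReal ((f x - f (x * g)) ^ 2)

lemma ofReal_add_sq_le (a b : ℝ) :
    ENNReal.ofReal ((a + b) ^ 2) ≤ 2 * ENNReal.ofReal (a ^ 2) + 2 * ENNReal.ofReal (b ^ 2) := by
  have h2 : (2 : ℝ≥0∞) = ENNReal.ofReal 2 := by simp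
  rw [h2, ← ENNReal.ofReal_mul (by norm_num), ← ENNReal.ofReal_mul (by norm_num),
    ← ENNReal.ofReal_add (by positivity) (by positivity)]
  exact ENNReal.ofReal_le_ofReal (by nlinarith [sq_nonneg (a - b)])

/-- Non-amenability in combinatorial form. In the relation `E`, every `y` is joined to at least
`2 * M + 1` points `y * g` with `g` in the finite set `B`, and every point is reached from at most
`M` points. Here `y * g` runs over points at distance `R` from `y` in directions that point away
from `1`, so the points `y` that reach a given `x` all lie near a geodesic from `x` to `1`, at
distance `R` from `x`: their number is bounded by the size of a ball that does not depend on
`R`. -/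
lemma exists_doubling_relation (hΓ : IsNonElementaryHyperbolicGroup Γ) :
    ∃ (B : Finset Γ) (M : ℕ) (E : Γ → Set Γ),
      (∀ y, 2 * M + 1 ≤ {g ∈ (B : Set Γ) | g ∈ E y}.ncard) ∧
      ∀ x, {g ∈ (B : Set Γ) | g ∈ E (x * g⁻¹)}.ncard ≤ M := by
  obtain ⟨S, hfin, hS, ⟨δ, hδ⟩, hbd⟩ := hΓ
  obtain ⟨C, hC⟩ := exists_branching hS hδ hbd
  obtain ⟨D, hD⟩ := exists_nat_ge (2 * C + 2 * δ)
  obtain ⟨k, hk⟩ : ∃ k : ℕ, 2 * {g : Γ | wordDist S 1 g ≤ D}.ncard + 1 < 2 ^ k :=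
    ⟨_, Nat.lt_two_pow_self⟩
  obtain ⟨ι, _, hcard, K, hK⟩ := hC k
  obtain ⟨R, hR⟩ := exists_nat_gt K
  have hB : {g : Γ | wordDist S 1 g = R}.Finite :=
    (finite_wordDist_le hfin hS R).subset fun g hg => le_of_eq hg
  -- `M` is the size of the ball of radius `2 * C + 2 * δ`, fixed before `k`, `K` and `R`
  refine ⟨hB.toFinset, {g : Γ | wordDist S 1 g ≤ D}.ncard,
    fun y => {g | gromovProduct S 1 g y⁻¹ ≤ C}, fun y => ?_, fun x => ?_⟩
  · obtain ⟨u, huR, huz, huu⟩ := hK R y⁻¹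
    have hinj : Function.Injective u := by
      intro i j hij
      by_contra hne
      have h1 := huu i j hne
      rw [hij] at h1
      unfold gromovProduct at h1
      rw [wordDist_self, huR] at h1
      norm_num at h1
      linarith
    have h1 : (Set.range u).ncard = Fintype.card ι := by
      rw [← Nat.card_coe_set_eq, Nat.card_range_of_injective hinj, Nat.card_eq_fintype_card]
    refine le_trans (b := (Set.range u).ncard) (by omega) (Set.ncard_le_ncard ?_ ?_)
    · rintro _ ⟨i, rfl⟩
      exact ⟨by simpa using huR i, huz i⟩
    · exact (Finset.finite_toSet _).subset fun g hg => hg.1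
  · rcases Set.eq_empty_or_nonempty {g ∈ (hB.toFinset : Set Γ) |
      g ∈ {g' | gromovProduct S 1 g' (x * g⁻¹)⁻¹ ≤ C}} with h | ⟨g₀, hg₀⟩
    · rw [h]; simp
    -- the points `x * g⁻¹` lie at distance `R` from `x` along a geodesic to `1`; everything is
    -- translated by `x⁻¹`
    have key : ∀ g, g ∈ {g ∈ (hB.toFinset : Set Γ) |
        g ∈ {g' | gromovProduct S 1 g' (x * g⁻¹)⁻¹ ≤ C}} →
        wordDist S 1 g⁻¹ = R ∧ (R : ℝ) - C ≤ gromovProduct S 1 g⁻¹ x⁻¹ := by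
      rintro g ⟨hgR, hg⟩
      have hgR' : wordDist S 1 g = R := by simpa using hgR
      have h1 : wordDist S 1 g⁻¹ = R := by
        rw [← wordDist_mul_left hS g, mul_inv_cancel, mul_one, wordDist_comm, hgR']
      have h2 : gromovProduct S 1 g (x * g⁻¹)⁻¹ ≤ C := hg
      rw [← gromovProduct_mul_left hS g⁻¹] at h2
      simp only [mul_one, inv_mul_cancel, mul_inv_rev, inv_inv, inv_mul_cancel_left] at h2
      refine ⟨h1, ?_⟩
      unfold gromovProduct at h2 ⊢
      rw [wordDist_comm g⁻¹ 1, h1] at h2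
      rw [h1]
      linarith
    refine Set.ncard_le_ncard_of_injOn (fun g => g₀ * g⁻¹) (fun g hg => ?_)
      (fun a _ b _ hab => by simpa using hab) (finite_wordDist_le hfin hS D)
    obtain ⟨h1, h2⟩ := key g hg
    obtain ⟨h3, h4⟩ := key g₀ hg₀
    have h5 := hδ 1 g⁻¹ x⁻¹ g₀⁻¹
    rw [gromovProduct_comm 1 x⁻¹] at h5
    have h6 := le_min h2 h4
    have h7 : (R : ℝ) - C - δ ≤ gromovProduct S 1 g⁻¹ g₀⁻¹ := by linarith
    unfold gromovProduct at h7
    rw [h1, h3] at h7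
    have h8 : (wordDist S g⁻¹ g₀⁻¹ : ℝ) ≤ D := by linarith
    change wordDist S 1 (g₀ * g⁻¹) ≤ D
    rw [← wordDist_mul_left hS g₀, mul_inv_cancel, wordDist_comm] at h8
    exact_mod_cast h8

/-- The spectral gap of a finite set of translations: by double counting over a doubling relation,
`∑_y (2 M + 1) f(y)² ≤ 2 ∑_x M f(x)² + 2 ∑ (f(y) - f(y g))²`. -/
lemma exists_sqSum_le_translationEnergy (hΓ : IsNonElementaryHyperbolicGroup Γ) :
    ∃ B : Finset Γ, ∀ f : Γ → ℝ, sqSum f ≠ ∞ →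
      sqSum f ≤ 2 * ∑ g ∈ B, translationEnergy g f := by
  classical
  obtain ⟨B, M, E, hout, hin⟩ := exists_doubling_relation hΓ
  refine ⟨B, fun f hf => ?_⟩
  have hcount : ∀ (P : Γ → Prop) (c : ℝ≥0∞),
      ∑ g ∈ B, (if P g then c else 0) = ({g ∈ (B : Set Γ) | P g}.ncard : ℝ≥0∞) * c := by
    intro P c
    rw [← Finset.sum_filter, Finset.sum_const, nsmul_eq_mul, ← Set.ncard_coe_finset]
    congr 3
    ext g
    simp
  have hlow : (2 * M + 1 : ℕ) * sqSum f ≤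
      ∑ g ∈ B, ∑' y, if g ∈ E y then ENNReal.ofReal (f y ^ 2) else 0 := by
    rw [← Summable.tsum_finsetSum (fun _ _ => ENNReal.summable), sqSum, ← ENNReal.tsum_mul_left]
    refine ENNReal.tsum_le_tsum fun y => ?_
    rw [hcount]
    gcongr
    exact hout y
  have hup : ∑ g ∈ B, ∑' y, (if g ∈ E y then ENNReal.ofReal (f (y * g) ^ 2) else 0) ≤
      M * sqSum f := by
    have hshift : ∀ g, ∑' y, (if g ∈ E y then ENNReal.ofReal (f (y * g) ^ 2) else 0) =
        ∑' x, if g ∈ E (x * g⁻¹) then ENNReal.ofReal (f x ^ 2) else 0 := by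
      intro g
      rw [← (Equiv.mulRight g).tsum_eq
        (fun x => if g ∈ E (x * g⁻¹) then ENNReal.ofReal (f x ^ 2) else 0)]
      simp
    simp_rw [hshift]
    rw [← Summable.tsum_finsetSum (fun _ _ => ENNReal.summable), sqSum, ← ENNReal.tsum_mul_left]
    refine ENNReal.tsum_le_tsum fun x => ?_
    rw [hcount]
    gcongr
    exact hin x
  have hmid : ∑ g ∈ B, ∑' y, (if g ∈ E y then ENNReal.ofReal (f y ^ 2) else 0) ≤
      2 * (M * sqSum f) + 2 * ∑ g ∈ B, translationEnergy g f := by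
    refine le_trans ?_ (add_le_add_left (mul_le_mul_right hup 2) _)
    rw [Finset.mul_sum, Finset.mul_sum, ← Finset.sum_add_distrib]
    refine Finset.sum_le_sum fun g _ => ?_
    rw [translationEnergy, ← ENNReal.tsum_mul_left, ← ENNReal.tsum_mul_left, ← ENNReal.tsum_add]
    refine ENNReal.tsum_le_tsum fun y => ?_
    split_ifs
    · simpa using ofReal_add_sq_le (f (y * g)) (f y - f (y * g))
    · exact zero_le
  have htot := hlow.trans hmid
  rw [Nat.cast_add, Nat.cast_one, add_mul, one_mul, Nat.cast_mul, Nat.cast_two, mul_assoc] at htot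
  refine (ENNReal.add_le_add_iff_left ?_).1 htot
  exact ENNReal.mul_ne_top (by simp) (ENNReal.mul_ne_top (by simp) hf)

/-- Since the support of `μ` generates `Γ`, the energy of `μ` controls every translation. -/
lemma exists_translationEnergy_le_walkEnergy {μ : PMF Γ} (hadm : IsAdmissible μ) (g : Γ) :
    ∃ C : ℝ≥0∞, C ≠ ∞ ∧ ∀ f : Γ → ℝ, translationEnergy g f ≤ C * walkEnergy μ f := by
  have hg : g ∈ Subgroup.closure μ.support := by
    have : Subgroup.closure μ.support = ⊤ := hadm
    rw [this]; exact Subgroup.mem_top g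
  induction hg using Subgroup.closure_induction with
  | mem s hs =>
    have hs0 : μ s ≠ 0 := (μ.mem_support_iff s).1 hs
    refine ⟨(μ s)⁻¹, ENNReal.inv_ne_top.2 hs0, fun f => ?_⟩
    rw [← ENNReal.mul_le_iff_le_inv hs0 (μ.apply_ne_top s), translationEnergy,
      ← ENNReal.tsum_mul_left, walkEnergy]
    refine ENNReal.tsum_le_tsum fun x => ?_
    simpa using ENNReal.le_tsum (f := fun y => μ (x⁻¹ * y) * ENNReal.ofReal ((f x - f y) ^ 2))
      (x * s)
  | one => exact ⟨0, by simp, fun f => by simp [translationEnergy]⟩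
  | mul a b _ _ ha hb =>
    obtain ⟨A, hA, hA'⟩ := ha
    obtain ⟨B, hB, hB'⟩ := hb
    refine ⟨2 * A + 2 * B, by finiteness, fun f => ?_⟩
    have h1 : translationEnergy (a * b) f ≤
        2 * translationEnergy a f + 2 * translationEnergy b f := by
      have hb : translationEnergy b f =
          ∑' x : Γ, ENNReal.ofReal ((f (x * a) - f (x * a * b)) ^ 2) :=
        ((Equiv.mulRight a).tsum_eq
          (fun x => ENNReal.ofReal ((f x - f (x * b)) ^ 2))).symm
      rw [hb, translationEnergy, translationEnergy, ← ENNReal.tsum_mul_left,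
        ← ENNReal.tsum_mul_left, ← ENNReal.tsum_add]
      refine ENNReal.tsum_le_tsum fun x => ?_
      simpa [mul_assoc] using ofReal_add_sq_le (f x - f (x * a)) (f (x * a) - f (x * a * b))
    refine h1.trans ?_
    rw [add_mul, mul_assoc, mul_assoc]
    gcongr
    · exact hA' f
    · exact hB' f
  | inv a _ ha =>
    obtain ⟨A, hA, hA'⟩ := ha
    refine ⟨A, hA, fun f => le_trans (le_of_eq ?_) (hA' f)⟩
    rw [translationEnergy, ← (Equiv.mulRight a).tsum_eq, translationEnergy]
    refine tsum_congr fun x => ?_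
    rw [Equiv.coe_mulRight, mul_inv_cancel_right, ← neg_sub, neg_sq]

/-- The spectral gap of the random walk. -/
lemma exists_sqSum_le_walkEnergy (hΓ : IsNonElementaryHyperbolicGroup Γ) {μ : PMF Γ}
    (hadm : IsAdmissible μ) :
    ∃ C : ℝ≥0∞, C ≠ ∞ ∧ ∀ f : Γ → ℝ, sqSum f ≠ ∞ → sqSum f ≤ C * walkEnergy μ f := by
  obtain ⟨B, hB⟩ := exists_sqSum_le_translationEnergy hΓ
  choose C hC hC' using exists_translationEnergy_le_walkEnergy hadm
  refine ⟨2 * ∑ g ∈ B, C g, ENNReal.mul_ne_top (by simp) (ENNReal.sum_ne_top.2 fun g _ => hC g),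
    fun f hf => (hB f hf).trans ?_⟩
  rw [mul_assoc, Finset.sum_mul]
  gcongr with g
  exact hC' g f

end SpectralGap

/-! ### Square summable functions -/

section SquareSummable

variable {α : Type*}

lemma hasSum_iff_of_forall_eq {f g : α → ℝ} {a : ℝ} (h : ∀ x, f x = g x) :
    HasSum f a ↔ HasSum g a := by rw [funext h]

lemma sqSum_ne_top_iff {f : α → ℝ} : sqSum f ≠ ∞ ↔ Summable fun x => f x ^ 2 := by
  unfold sqSum
  refine ⟨fun h => ?_, fun h => h.tsum_ofReal_ne_top⟩
  have := ENNReal.summable_toReal h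
  simpa only [ENNReal.toReal_ofReal (sq_nonneg _)] using this

lemma memℓp_two_iff {f : α → ℝ} : Memℓp f 2 ↔ sqSum f ≠ ∞ := by
  rw [sqSum_ne_top_iff, memℓp_gen_iff (by norm_num)]
  simp

lemma sqSum_coe (F : lp (fun _ : α => ℝ) 2) : sqSum F = ENNReal.ofReal (‖F‖ ^ 2) := by
  have h := lp.norm_rpow_eq_tsum (p := 2) (by norm_num) F
  have h2 := sqSum_ne_top_iff.1 (memℓp_two_iff.1 (lp.memℓp F))
  have h3 : ‖F‖ ^ 2 = ∑' x, F x ^ 2 := by simpa using h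
  rw [h3, ENNReal.ofReal_tsum_of_nonneg (fun _ => sq_nonneg _) h2, sqSum]

end SquareSummable

/-! ### The differential and the Laplacian -/

section Differential

variable {Γ : Type*} [Group Γ] {μ : PMF Γ}

lemma mem_ellTwo_iff {Γ : Type*} {f : Γ → ℝ} : f ∈ ellTwo Γ ↔ sqSum f ≠ ∞ := sqSum_ne_top_iff.symm

/-- The differential `df(x, y) = √μ(x⁻¹y) (f(x) - f(y))`, so that `𝓔^μ(f, g)` is the inner product
of `df` and `dg` in `ℓ²(Γ × Γ)`. -/
noncomputable def edgeDiff (μ : PMF Γ) (f : Γ → ℝ) (p : Γ × Γ) : ℝ :=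
  √(μ (p.1⁻¹ * p.2)).toReal * (f p.1 - f p.2)

lemma edgeDiff_add (f g : Γ → ℝ) : edgeDiff μ (f + g) = edgeDiff μ f + edgeDiff μ g := by
  ext p
  simp only [edgeDiff, Pi.add_apply]
  ring

lemma edgeDiff_sub (f g : Γ → ℝ) : edgeDiff μ (f - g) = edgeDiff μ f - edgeDiff μ g := by
  ext p
  simp only [edgeDiff, Pi.sub_apply]
  ring

lemma edgeDiff_smul (c : ℝ) (f : Γ → ℝ) : edgeDiff μ (c • f) = c • edgeDiff μ f := by
  ext p
  simp only [edgeDiff, Pi.smul_apply, smul_eq_mul]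
  ring

lemma edgeDiff_mul_edgeDiff (f g : Γ → ℝ) (p : Γ × Γ) :
    edgeDiff μ f p * edgeDiff μ g p =
      (μ (p.1⁻¹ * p.2)).toReal * ((f p.1 - f p.2) * (g p.1 - g p.2)) := by
  have h := Real.mul_self_sqrt (ENNReal.toReal_nonneg (a := μ (p.1⁻¹ * p.2)))
  calc edgeDiff μ f p * edgeDiff μ g p
      = (√(μ (p.1⁻¹ * p.2)).toReal * √(μ (p.1⁻¹ * p.2)).toReal) *
        ((f p.1 - f p.2) * (g p.1 - g p.2)) := by unfold edgeDiff; ring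
    _ = _ := by rw [h]

lemma walkEnergy_eq_sqSum (f : Γ → ℝ) : walkEnergy μ f = sqSum (edgeDiff μ f) := by
  rw [sqSum, ENNReal.tsum_prod', walkEnergy]
  refine tsum_congr fun x => tsum_congr fun y => ?_
  rw [sq (edgeDiff μ f (x, y)), edgeDiff_mul_edgeDiff, ENNReal.ofReal_mul ENNReal.toReal_nonneg,
    ENNReal.ofReal_toReal (μ.apply_ne_top _), ← sq]

lemma mem_finiteEnergy_iff {f : Γ → ℝ} : f ∈ finiteEnergy μ ↔ Memℓp (edgeDiff μ f) 2 := by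
  rw [memℓp_two_iff, ← walkEnergy_eq_sqSum, ← lt_top_iff_ne_top]
  rfl

lemma walkEnergy_le (f : Γ → ℝ) : walkEnergy μ f ≤ 4 * sqSum f := by
  have hrow : ∀ x : Γ, ∑' y, μ (x⁻¹ * y) = 1 := fun x => by
    rw [← μ.tsum_coe]
    exact (Equiv.mulLeft x⁻¹).tsum_eq (fun y => μ y)
  have hcol : ∀ y : Γ, ∑' x, μ (x⁻¹ * y) = 1 := fun y => by
    rw [← μ.tsum_coe]
    exact ((Equiv.inv Γ).trans (Equiv.mulRight y)).tsum_eq (fun y => μ y)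
  calc walkEnergy μ f
      ≤ ∑' x : Γ, ∑' y : Γ, (2 * (ENNReal.ofReal (f x ^ 2) * μ (x⁻¹ * y)) +
          2 * (ENNReal.ofReal (f y ^ 2) * μ (x⁻¹ * y))) := by
        refine ENNReal.tsum_le_tsum fun x => ENNReal.tsum_le_tsum fun y => ?_
        have h := ofReal_add_sq_le (f x) (-f y)
        rw [← sub_eq_add_neg, neg_sq] at h
        calc μ (x⁻¹ * y) * ENNReal.ofReal ((f x - f y) ^ 2)
            ≤ μ (x⁻¹ * y) * (2 * ENNReal.ofReal (f x ^ 2) + 2 * ENNReal.ofReal (f y ^ 2)) := by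
              gcongr
          _ = _ := by ring
    _ = 4 * sqSum f := by
        simp_rw [ENNReal.tsum_add, ENNReal.tsum_mul_left, hrow]
        rw [ENNReal.tsum_comm]
        simp_rw [ENNReal.tsum_mul_left, hcol, mul_one]
        rw [← sqSum]
        ring

lemma ellTwo_subset_finiteEnergy : ellTwo Γ ⊆ finiteEnergy μ := fun f hf =>
  (walkEnergy_le f).trans_lt (ENNReal.mul_lt_top (by simp) (mem_ellTwo_iff.1 hf).lt_top)

/-- The differential as an element of `ℓ²(Γ × Γ)`. -/
noncomputable def edgeDiffLp {f : Γ → ℝ} (hf : f ∈ finiteEnergy μ) : lp (fun _ : Γ × Γ => ℝ) 2 :=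
  ⟨edgeDiff μ f, mem_finiteEnergy_iff.1 hf⟩

lemma coe_mem_finiteEnergy (F : lp (fun _ : Γ => ℝ) 2) : (F : Γ → ℝ) ∈ finiteEnergy μ :=
  ellTwo_subset_finiteEnergy (mem_ellTwo_iff.2 (memℓp_two_iff.1 (lp.memℓp F)))

lemma walkEnergy_eq_norm {f : Γ → ℝ} (hf : f ∈ finiteEnergy μ) :
    walkEnergy μ f = ENNReal.ofReal (‖edgeDiffLp hf‖ ^ 2) := by
  rw [walkEnergy_eq_sqSum, ← sqSum_coe]
  rfl

/-- The differential as a bounded operator `ℓ²(Γ) → ℓ²(Γ × Γ)`. -/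
noncomputable def edgeDiffCLM (μ : PMF Γ) : lp (fun _ : Γ => ℝ) 2 →L[ℝ] lp (fun _ : Γ × Γ => ℝ) 2 :=
  LinearMap.mkContinuous
    { toFun := fun F => edgeDiffLp (coe_mem_finiteEnergy (μ := μ) F)
      map_add' := fun F G => Subtype.ext (edgeDiff_add _ _)
      map_smul' := fun c F => Subtype.ext (edgeDiff_smul c _) } 2 fun F => by
    have h := walkEnergy_le (μ := μ) (F : Γ → ℝ)
    rw [walkEnergy_eq_norm (coe_mem_finiteEnergy F), sqSum_coe,
      show (4 : ℝ≥0∞) = ENNReal.ofReal 4 by simp, ← ENNReal.ofReal_mul (by norm_num),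
      ENNReal.ofReal_le_ofReal_iff (by positivity)] at h
    refine le_of_sq_le_sq ?_ (by positivity)
    rw [mul_pow]
    norm_num
    exact h

lemma inner_edgeDiffLp {f g : Γ → ℝ} (hf : f ∈ finiteEnergy μ) (hg : g ∈ finiteEnergy μ) :
    HasSum (fun p => edgeDiff μ f p * edgeDiff μ g p)
      (inner ℝ (edgeDiffLp hf) (edgeDiffLp hg)) := by
  refine (hasSum_iff_of_forall_eq fun p => ?_).1
    (lp.hasSum_inner (𝕜 := ℝ) (edgeDiffLp hf) (edgeDiffLp hg))
  exact mul_comm (edgeDiff μ g p) (edgeDiff μ f p)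

/-- The Laplacian as the adjoint of the differential: `𝓔^μ(δ_x, h) = -2 Δ_μ h(x)`. -/
lemma inner_edgeDiff_single [DecidableEq Γ] (hsymm : IsSymmetricMeasure μ) {h : Γ → ℝ}
    (hh : h ∈ finiteEnergy μ) (x : Γ) :
    inner ℝ (edgeDiffCLM μ (lp.single 2 x (1 : ℝ))) (edgeDiffLp hh) =
      -2 * walkLaplacian μ h x := by
  have hμ : HasSum (fun y => (μ (x⁻¹ * y)).toReal) 1 := by
    have h1 : HasSum (fun y => (μ y).toReal) 1 := by
      have h2 : ∑' y, (μ y).toReal = 1 := by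
        rw [← ENNReal.tsum_toReal_eq μ.apply_ne_top, μ.tsum_coe, ENNReal.toReal_one]
      rw [← h2]
      exact ENNReal.hasSum_toReal μ.tsum_coe_ne_top
    exact (Equiv.hasSum_iff (f := fun y => (μ y).toReal) (Equiv.mulLeft x⁻¹)).2 h1
  -- the differential of `h` is square summable along the edges from `x`, hence summable
  -- for the probability weights `μ (x⁻¹ y)`
  have hs : Summable fun y => (μ (x⁻¹ * y)).toReal * (h x - h y) := by
    have h2 : Summable fun y => (μ (x⁻¹ * y)).toReal * ((h x - h y) * (h x - h y)) := by
      have h3 := (inner_edgeDiffLp hh hh).summable.comp_injective (Prod.mk_right_injective x)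
      exact h3.congr fun y => edgeDiff_mul_edgeDiff h h (x, y)
    refine Summable.of_norm_bounded (hμ.summable.add h2) fun y => ?_
    have h0 := ENNReal.toReal_nonneg (a := μ (x⁻¹ * y))
    rw [norm_mul, Real.norm_of_nonneg h0, ← mul_one_add]
    refine mul_le_mul_of_nonneg_left ?_ h0
    rw [Real.norm_eq_abs, ← abs_mul_abs_self (h x - h y)]
    nlinarith [sq_nonneg (|h x - h y| - 1), abs_nonneg (h x - h y)]
  have hlap : HasSum (fun y => (μ (x⁻¹ * y)).toReal * (h x - h y)) (- walkLaplacian μ h x) := by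
    have h2 : HasSum (fun y => (μ (x⁻¹ * y)).toReal * h y)
        (h x - ∑' y, (μ (x⁻¹ * y)).toReal * (h x - h y)) := by
      have := (hμ.mul_right (h x)).sub hs.hasSum
      rw [one_mul] at this
      exact (hasSum_iff_of_forall_eq fun y => by ring).1 this
    have h3 : - walkLaplacian μ h x = ∑' y, (μ (x⁻¹ * y)).toReal * (h x - h y) := by
      rw [walkLaplacian, h2.tsum_eq]
      ring
    rw [h3]
    exact hs.hasSum
  have hout : HasSum (fun p : Γ × Γ => if p.1 = x then
      (μ (p.1⁻¹ * p.2)).toReal * (h p.1 - h p.2) else 0) (- walkLaplacian μ h x) := by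
    refine ((Prod.mk_right_injective x).hasSum_iff ?_).1
      ((hasSum_iff_of_forall_eq fun y => by simp).1 hlap)
    rintro ⟨a, b⟩ hab
    refine if_neg fun hax => hab ⟨b, ?_⟩
    simp_all
  have hin : HasSum (fun p : Γ × Γ => if p.2 = x then
      (μ (p.1⁻¹ * p.2)).toReal * (h p.1 - h p.2) else 0) (walkLaplacian μ h x) := by
    have := ((Equiv.hasSum_iff (Equiv.prodComm Γ Γ)).2 hout).neg
    rw [neg_neg] at this
    refine (hasSum_iff_of_forall_eq fun p => ?_).1 this
    rw [Function.comp_apply, Equiv.prodComm_apply, Prod.fst_swap, Prod.snd_swap]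
    split_ifs
    · rw [← hsymm, mul_inv_rev, inv_inv]
      ring
    · simp
  have htot := hout.sub hin
  have hinner := inner_edgeDiffLp (coe_mem_finiteEnergy (μ := μ) (lp.single 2 x (1 : ℝ))) hh
  refine (hinner.unique ?_).trans (by ring : - walkLaplacian μ h x - walkLaplacian μ h x = _)
  refine (hasSum_iff_of_forall_eq fun p => ?_).1 htot
  rw [edgeDiff_mul_edgeDiff, lp.coeFn_single]
  by_cases h1 : p.1 = x <;> by_cases h2 : p.2 = x <;> (simp [h1, h2]; try ring)

/-- The differentials of harmonic functions are orthogonal to those of square summable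
functions. -/
lemma inner_edgeDiffCLM_eq_zero (hsymm : IsSymmetricMeasure μ) {h : Γ → ℝ}
    (hh : h ∈ harmonicFiniteEnergy μ) (F : lp (fun _ : Γ => ℝ) 2) :
    inner ℝ (edgeDiffCLM μ F) (edgeDiffLp hh.1) = 0 := by
  classical
  have h1 := lp.hasSum_single (by simp) F
  have h2 := (h1.mapL (edgeDiffCLM μ)).mapL (innerSL ℝ (edgeDiffLp hh.1))
  rw [real_inner_comm]
  refine HasSum.unique h2 ?_
  convert hasSum_zero using 2 with x
  have h3 : lp.single (E := fun _ : Γ => ℝ) 2 x (F x) = F x • lp.single 2 x (1 : ℝ) := by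
    rw [← lp.single_smul, smul_eq_mul, mul_one]
  rw [h3, map_smul, map_smul, innerSL_apply_apply, real_inner_comm,
    inner_edgeDiff_single hsymm hh.1 x, hh.2 x]
  simp

end Differential

/-! ### The orthogonal decomposition -/

section Decomposition

variable {Γ : Type*} [Group Γ] {μ : PMF Γ}

/-- The differential of `ℓ²(Γ)` has closed range, by the spectral gap. -/
lemma isClosed_range_edgeDiffCLM {C : ℝ≥0∞} (hC : C ≠ ∞)
    (hgap : ∀ f : Γ → ℝ, sqSum f ≠ ∞ → sqSum f ≤ C * walkEnergy μ f) :
    IsClosed (Set.range (edgeDiffCLM μ)) := by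
  have hanti : AntilipschitzWith (NNReal.sqrt C.toNNReal) (edgeDiffCLM μ) := by
    refine ContinuousLinearMap.antilipschitz_of_bound _ fun F => ?_
    have h := hgap F (memℓp_two_iff.1 (lp.memℓp F))
    rw [walkEnergy_eq_norm (coe_mem_finiteEnergy F), sqSum_coe, ← ENNReal.ofReal_toReal hC,
      ← ENNReal.ofReal_mul ENNReal.toReal_nonneg,
      ENNReal.ofReal_le_ofReal_iff (by positivity)] at h
    refine le_of_sq_le_sq (h.trans (le_of_eq ?_)) (by positivity)
    rw [mul_pow, ← NNReal.coe_pow, NNReal.sq_sqrt]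
    rfl
  exact hanti.isClosed_range (edgeDiffCLM μ).uniformContinuous

/-- Existence of the decomposition: `df` is projected orthogonally to the differentials of
square summable functions. -/
lemma exists_add_eq_of_mem_finiteEnergy (hsymm : IsSymmetricMeasure μ)
    (hclosed : IsClosed (Set.range (edgeDiffCLM μ))) {f : Γ → ℝ} (hf : f ∈ finiteEnergy μ) :
    ∃ f₀ ∈ ellTwo Γ, ∃ h ∈ harmonicFiniteEnergy μ, f = f₀ + h := by
  classical
  let V : Submodule ℝ (lp (fun _ : Γ × Γ => ℝ) 2) := LinearMap.range (edgeDiffCLM μ).toLinearMap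
  have hV : IsClosed (V : Set (lp (fun _ : Γ × Γ => ℝ) 2)) := by
    rw [LinearMap.coe_range]
    exact hclosed
  have : CompleteSpace V := hV.completeSpace_coe
  obtain ⟨v, ⟨F, hF⟩, w, hw, hvw⟩ := V.exists_add_mem_mem_orthogonal (edgeDiffLp hf)
  have hF' : edgeDiffCLM μ F = v := hF
  have hw' : edgeDiff μ (f - F) = w := by
    have h1 : edgeDiff μ f = v + w := congrArg Subtype.val hvw
    have h2 : edgeDiff μ F = v := congrArg Subtype.val hF'
    rw [edgeDiff_sub, h1, h2, add_sub_cancel_left]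
  have hmem : f - F ∈ finiteEnergy μ := by
    rw [mem_finiteEnergy_iff, hw']
    exact lp.memℓp w
  refine ⟨F, mem_ellTwo_iff.2 (memℓp_two_iff.1 (lp.memℓp F)), f - F, ⟨hmem, fun x => ?_⟩,
    (add_sub_cancel _ _).symm⟩
  have h1 := inner_edgeDiff_single hsymm hmem x
  have h2 : edgeDiffLp hmem = w := Subtype.ext hw'
  have h3 : edgeDiffCLM μ (lp.single 2 x (1 : ℝ)) ∈ V := ⟨_, rfl⟩
  rw [h2, Submodule.inner_right_of_mem_orthogonal h3 hw] at h1
  linarith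

lemma hasSum_edgeDiff_mul_zero (hsymm : IsSymmetricMeasure μ) {f₀ h : Γ → ℝ}
    (hf₀ : f₀ ∈ ellTwo Γ) (hh : h ∈ harmonicFiniteEnergy μ) :
    HasSum (fun p => edgeDiff μ f₀ p * edgeDiff μ h p) 0 := by
  let F : lp (fun _ : Γ => ℝ) 2 := ⟨f₀, memℓp_two_iff.2 (mem_ellTwo_iff.1 hf₀)⟩
  rw [← inner_edgeDiffCLM_eq_zero hsymm hh F]
  exact inner_edgeDiffLp (ellTwo_subset_finiteEnergy hf₀) hh.1

lemma walkEnergy_add_of_mem (hsymm : IsSymmetricMeasure μ) {f₀ h : Γ → ℝ}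
    (hf₀ : f₀ ∈ ellTwo Γ) (hh : h ∈ harmonicFiniteEnergy μ) :
    walkEnergy μ (f₀ + h) = walkEnergy μ f₀ + walkEnergy μ h := by
  have hf₀' := ellTwo_subset_finiteEnergy (μ := μ) hf₀
  have hsq : ∀ {g : Γ → ℝ}, g ∈ finiteEnergy μ → Summable fun p => edgeDiff μ g p ^ 2 :=
    fun hg => sqSum_ne_top_iff.1 (memℓp_two_iff.1 (mem_finiteEnergy_iff.1 hg))
  have h0 := (hasSum_edgeDiff_mul_zero hsymm hf₀ hh).mul_left 2
  have hadd := ((hsq hf₀').hasSum.add h0).add (hsq hh.1).hasSum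
  have hsum : HasSum (fun p => edgeDiff μ (f₀ + h) p ^ 2) _ :=
    (hasSum_iff_of_forall_eq fun p => by rw [edgeDiff_add, Pi.add_apply]; ring).1 hadd
  simp only [walkEnergy_eq_sqSum, sqSum]
  rw [← ENNReal.ofReal_tsum_of_nonneg (fun _ => sq_nonneg _) hsum.summable, hsum.tsum_eq,
    ← ENNReal.ofReal_tsum_of_nonneg (fun _ => sq_nonneg _) (hsq hf₀'),
    ← ENNReal.ofReal_tsum_of_nonneg (fun _ => sq_nonneg _) (hsq hh.1),
    mul_zero, add_zero, ENNReal.ofReal_add (tsum_nonneg fun _ => sq_nonneg _)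
      (tsum_nonneg fun _ => sq_nonneg _)]

lemma sub_mem_ellTwo {Γ : Type*} {f g : Γ → ℝ} (hf : f ∈ ellTwo Γ) (hg : g ∈ ellTwo Γ) :
    f - g ∈ ellTwo Γ :=
  mem_ellTwo_iff.2 (memℓp_two_iff.1 ((memℓp_two_iff.2 (mem_ellTwo_iff.1 hf)).sub
    (memℓp_two_iff.2 (mem_ellTwo_iff.1 hg))))

/-- Uniqueness of the decomposition: the difference of two square summable parts is orthogonal to
itself for the energy, so the spectral gap makes it vanish. -/
lemma eq_of_add_eq_add (hsymm : IsSymmetricMeasure μ) {C : ℝ≥0∞}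
    (hgap : ∀ f : Γ → ℝ, sqSum f ≠ ∞ → sqSum f ≤ C * walkEnergy μ f) {f₀ g₀ h k : Γ → ℝ}
    (hf₀ : f₀ ∈ ellTwo Γ) (hg₀ : g₀ ∈ ellTwo Γ) (hh : h ∈ harmonicFiniteEnergy μ)
    (hk : k ∈ harmonicFiniteEnergy μ) (heq : f₀ + h = g₀ + k) : f₀ = g₀ ∧ h = k := by
  have hd := sub_mem_ellTwo hf₀ hg₀
  have hdk : f₀ - g₀ = k - h := by
    rw [sub_eq_sub_iff_add_eq_add, heq, add_comm]
  have h1 := (hasSum_edgeDiff_mul_zero hsymm hd hk).sub (hasSum_edgeDiff_mul_zero hsymm hd hh)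
  have h2 : HasSum (fun p => edgeDiff μ (f₀ - g₀) p ^ 2) 0 := by
    rw [sub_zero] at h1
    refine (hasSum_iff_of_forall_eq fun p => ?_).1 h1
    rw [← mul_sub, ← Pi.sub_apply, ← edgeDiff_sub, ← hdk, sq]
  have h3 : walkEnergy μ (f₀ - g₀) = 0 := by
    rw [walkEnergy_eq_sqSum, sqSum,
      ← ENNReal.ofReal_tsum_of_nonneg (fun _ => sq_nonneg _) h2.summable, h2.tsum_eq,
      ENNReal.ofReal_zero]
  have h4 : sqSum (f₀ - g₀) = 0 := by
    have := hgap _ (mem_ellTwo_iff.1 hd)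
    rwa [h3, mul_zero, nonpos_iff_eq_zero] at this
  have h5 : f₀ = g₀ := by
    rw [← sub_eq_zero]
    ext x
    have := ENNReal.tsum_eq_zero.1 h4 x
    rw [ENNReal.ofReal_eq_zero] at this
    exact pow_eq_zero_iff (two_ne_zero) |>.1 (le_antisymm this (sq_nonneg _))
  subst h5
  exact ⟨rfl, add_left_cancel heq⟩

lemma walkEnergyOne_le (f : Γ → ℝ) : walkEnergyOne μ f ≤ 5 * sqSum f := by
  calc walkEnergyOne μ f ≤ 4 * sqSum f + sqSum f := add_le_add_left (walkEnergy_le f) _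
    _ = 5 * sqSum f := by ring

lemma ellTwo_eq_energyOneClosure :
    ellTwo Γ = energyOneClosure μ (finitelySupported Γ) := by
  classical
  refine Set.Subset.antisymm (fun f hf ε hε => ?_) fun f hf => ?_
  · have htail := ENNReal.tendsto_tsum_compl_atTop_zero (mem_ellTwo_iff.1 hf)
    have hε5 : 0 < ε / 5 := ENNReal.div_pos hε.ne' (by simp)
    obtain ⟨s, hs⟩ := (htail.eventually (gt_mem_nhds hε5)).exists
    refine ⟨(s : Set Γ).indicator f, s.finite_toSet.subset Set.support_indicator_subset,
      (walkEnergyOne_le _).trans_lt ?_⟩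
    have h1 : sqSum (f - (s : Set Γ).indicator f) =
        ∑' x : {x // x ∉ s}, ENNReal.ofReal (f x ^ 2) := by
      rw [sqSum, ← tsum_subtype_eq_of_support_subset (s := {x | x ∉ s})]
      · refine tsum_congr fun x => ?_
        have hx : (x : Γ) ∉ (s : Set Γ) := fun h => x.2 (Finset.mem_coe.1 h)
        rw [Pi.sub_apply, Set.indicator_of_notMem hx, sub_zero]
      · intro x hx hxs
        apply hx
        have hx' : x ∈ (s : Set Γ) := by simpa using hxs
        simp [Set.indicator_of_mem hx']
    rw [h1, mul_comm]
    exact (ENNReal.lt_div_iff_mul_lt (by simp) (by simp)).1 hs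
  · obtain ⟨g, hg, hfg⟩ := hf 1 one_pos
    have h1 : f - g ∈ ellTwo Γ := by
      refine mem_ellTwo_iff.2 (ne_top_of_lt (lt_of_le_of_lt ?_ hfg))
      exact le_add_self
    have h2 : -g ∈ ellTwo Γ := by
      refine summable_of_hasFiniteSupport (Set.Finite.subset hg fun x hx => ?_)
      simpa using hx
    simpa using sub_mem_ellTwo h1 h2

end Decomposition

theorem proposition4p1 {Γ : Type*} [Group Γ] (hΓ : IsNonElementaryHyperbolicGroup Γ)
    (μ : PMF Γ) (hsymm : IsSymmetricMeasure μ) (hadm : IsAdmissible μ) :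
    -- inclusion
    ellTwo Γ ⊆ finiteEnergy μ ∧
    -- existence and uniqueness of the decomposition
    (∀ f ∈ finiteEnergy μ, ∃! p : (Γ → ℝ) × (Γ → ℝ),
      p.1 ∈ ellTwo Γ ∧ p.2 ∈ harmonicFiniteEnergy μ ∧ f = p.1 + p.2) ∧
    -- energies add
    (∀ f₀ ∈ ellTwo Γ, ∀ h ∈ harmonicFiniteEnergy μ,
      walkEnergy μ (f₀ + h) = walkEnergy μ f₀ + walkEnergy μ h) ∧
    -- orthogonality for the bilinear form, whose defining series converges absolutely
    (∀ f₀ ∈ ellTwo Γ, ∀ h ∈ harmonicFiniteEnergy μ,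
      HasSum (fun p : Γ × Γ =>
        (μ (p.1⁻¹ * p.2)).toReal * ((f₀ p.1 - f₀ p.2) * (h p.1 - h p.2))) 0) ∧
    -- the closure of the finitely supported functions
    ellTwo Γ = energyOneClosure μ (finitelySupported Γ) := by
  obtain ⟨C, hC, hgap⟩ := exists_sqSum_le_walkEnergy hΓ hadm
  refine ⟨ellTwo_subset_finiteEnergy, fun f hf => ?_, fun f₀ hf₀ h hh =>
    walkEnergy_add_of_mem hsymm hf₀ hh, fun f₀ hf₀ h hh => ?_, ellTwo_eq_energyOneClosure⟩
  · obtain ⟨f₀, hf₀, h, hh, hfh⟩ :=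
      exists_add_eq_of_mem_finiteEnergy hsymm (isClosed_range_edgeDiffCLM hC hgap) hf
    refine ⟨(f₀, h), ⟨hf₀, hh, hfh⟩, ?_⟩
    rintro ⟨g₀, k⟩ ⟨hg₀, hk, hgk⟩
    obtain ⟨h1, h2⟩ := eq_of_add_eq_add hsymm hgap hg₀ hf₀ hk hh (hgk.symm.trans hfh)
    exact Prod.ext h1 h2
  · exact (hasSum_iff_of_forall_eq fun p => edgeDiff_mul_edgeDiff f₀ h p).1
      (hasSum_edgeDiff_mul_zero hsymm hf₀ hh)
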